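/- Let $n\ge 1$, let $M$ be a smooth manifold of dimension $n+1$ with a smooth codimension-one foliation $\mathcal F$, and let $N$ be a smooth vector field on $M$ transversal to $\mathcal F$. A smooth Riemannian metric $g$ on $M$ is called adapted if $g(N,T\mathcal F)=0$ and $g(N,N)=1$; its $\mathcal F$-truncation is $\hat g(u,v)=g(\hat u,\hat v)$, where $\hat u=u-g(u,N)N$ is the $T\mathcal F$-component of $u$. Let $k_1,\dots,k_n$ be the principal curvatures of $\mathcal F$ with respect to an adapted metric $g$, that is, the eigenvalues (with multiplicity) of the Weingarten operator $A(X)=-(\nabla_XN)^\top$ on $T\mathcal F$, where $\nabla$ is the Levi-Civita connection of $g$, and put $\tau_j=\sum_i k_i^{\,j}$ and $\sigma_j=\sum_{i_1<\dots<i_j}k_{i_1}\cdots k_{i_j}$. Let $J\subseteq\mathbb R$ be an interval containing $0$ (for example $[0,\varepsilon)$) and let $g_t$, $t\in J$, be adapted metrics with $\partial_t g_t=s_t\,\hat g_t$ for some functions $s_t:M\to\mathbb R$. Denote by $\tau_k^t,\sigma_k^t$ the functions $\tau_k,\sigma_k$ of $g_t$. Then for all $t\in J$, at every point of $M$, $$\tau_k^t=F_k(\tau_1^t)\quad(k\ge1),\qquad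 F_k(y)=\frac{1}{n^{k-1}}\,y^k+\sum_{i=2}^{k}\frac{k!}{i!\,(k-i)!}\cdot\frac{\phi_i}{n^{k-i}}\,y^{k-i},$$ $$\sigma_k^t=\Psi_k(\sigma_1^t)\quad(1\le k\le n),\qquad \Psi_k(y)=\frac{(n-1)!}{k!\,(n-k)!}\cdot\frac{1}{n^{k-1}}\,y^k+\sum_{i=2}^{k}\frac{(n-i)!}{(k-i)!\,(n-k)!}\cdot\frac{\psi_i}{n^{k-i}}\,y^{k-i}.$$ Here $\phi_k$ ($k\ge2$) and $\psi_k$ ($2\le k\le n$) are $t$-independent functions on $M$, determined by the metric $g_0$ through the recursions $$\phi_k=\tau_k^0-\frac{(\tau_1^0)^k}{n^{k-1}}-\sum_{i=2}^{k-1}\frac{k!}{i!\,(k-i)!}\cdot\frac{\phi_i}{n^{k-i}}\,(\tau_1^0)^{k-i},$$ $$\psi_k=\sigma_k^0-\frac{(n-1)!}{k!\,(n-k)!}\cdot\frac{(\sigma_1^0)^k}{n^{k-1}}-\sum_{i=2}^{k-1}\frac{(n-i)!}{(k-i)!\,(n-k)!}\cdot\frac{\psi_i}{n^{k-i}}\,(\sigma_1^0)^{k-i},$$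 and $\phi_k=F_k(0)$, $\psi_k=\Psi_k(0)$. In particular, $$F_2(y)=\tfrac1n y^2+\phi_2,\quad F_3(y)=\tfrac1{n^2}y^3+\tfrac3n\phi_2\,y+\phi_3,\quad F_4(y)=\tfrac1{n^3}y^4+\tfrac6{n^2}\phi_2\,y^2+\tfrac4n\phi_3\,y+\phi_4,$$ $$\Psi_2(y)=\tfrac{n-1}{2n}y^2+\psi_2\ \ (n\ge2),\qquad \Psi_3(y)=\tfrac{(n-1)(n-2)}{6n^2}y^3+\tfrac{n-2}{n}\psi_2\,y+\psi_3\ \ (n\ge3).$$ -/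

import Mathlib

open Bundle VectorField
open scoped Manifold ContDiff

noncomputable section

set_option linter.unusedSectionVars false

/-! ## The Levi-Civita connection -/

section LeviCivita

variable {E : Type*} [NormedAddCommGroup E] [NormedSpace ℝ E] [FiniteDimensional ℝ E]
  {H : Type*} [TopologicalSpace H] {I : ModelWithCorners ℝ E H}
  {M : Type*} [TopologicalSpace M] [ChartedSpace H M] [IsManifold I ∞ M]

/-- A smooth Riemannian metric on the manifold `M`. -/
abbrev SmoothMetric (I : ModelWithCorners ℝ E H) (M : Type*) [TopologicalSpace M]
    [ChartedSpace H M] [IsManifold I ∞ M] : Type _ :=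
  ContMDiffRiemannianMetric I ∞ E (fun x : M ↦ TangentSpace I x)

theorem SmoothMetric.mdifferentiableAt (g : SmoothMetric I M)
    {X Y : Π x : M, TangentSpace I x} {x : M} (hX : MDiffAt (T% X) x) (hY : MDiffAt (T% Y) x) :
    MDiffAt (fun y ↦ g.inner y (X y) (Y y)) x := by
  have hg : MDifferentiableAt I (I.prod 𝓘(ℝ, E →L[ℝ] E →L[ℝ] ℝ))
      (fun b ↦ TotalSpace.mk' (E →L[ℝ] E →L[ℝ] ℝ)
        (E := fun b : M ↦ TangentSpace I b →L[ℝ] TangentSpace I b →L[ℝ] ℝ) b (g.inner b)) x :=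
    g.contMDiff.mdifferentiableAt (by simp)
  have : MDifferentiableAt I (I.prod 𝓘(ℝ))
      (fun m ↦ TotalSpace.mk' ℝ (E := Bundle.Trivial M ℝ) m (g.inner m (X m) (Y m))) x := by
    apply MDifferentiableAt.clm_bundle_apply₂ (F₁ := E) (F₂ := E)
    · exact hg
    · exact hX
    · exact hY
  simp only [mdifferentiableAt_totalSpace] at this
  exact this.2

/-- Half of the right-hand side of the Koszul formula; it equals `g(∇_X Y, Z)`. -/
def koszul (g : SmoothMetric I M) (X Y Z : Π x : M, TangentSpace I x) (x : M) : ℝ :=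
  (1 / 2 : ℝ) *
    (d% (fun y ↦ g.inner y (Y y) (Z y)) x (X x)
      + d% (fun y ↦ g.inner y (X y) (Z y)) x (Y x)
      - d% (fun y ↦ g.inner y (X y) (Y y)) x (Z x)
      + g.inner x (mlieBracket I X Y x) (Z x)
      - g.inner x (mlieBracket I X Z x) (Y x)
      - g.inner x (mlieBracket I Y Z x) (X x))

theorem koszul_tensorial_left (g : SmoothMetric I M) {Y Z : Π x : M, TangentSpace I x} {x : M}
    (hY : MDiffAt (T% Y) x) (hZ : MDiffAt (T% Z) x) :
    TensorialAt I E (fun X ↦ koszul g X Y Z x) x where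
  smul {f X} hf hX := by
    have h1 := mvfderiv_mul hf (g.mdifferentiableAt hX hZ)
    have h2 := mvfderiv_mul hf (g.mdifferentiableAt hX hY)
    have e1 : (fun y ↦ g.inner y ((f • X) y) (Z y)) = f * fun y ↦ g.inner y (X y) (Z y) := by
      ext y; simp
    have e2 : (fun y ↦ g.inner y ((f • X) y) (Y y)) = f * fun y ↦ g.inner y (X y) (Y y) := by
      ext y; simp
    simp only [koszul, e1, e2, h1, h2, mlieBracket_smul_left hf hX]
    simp [g.symm x _ (X x)]
    ring
  add {X X'} hX hX' := by
    have h1 := mvfderiv_add (g.mdifferentiableAt hX hZ) (g.mdifferentiableAt hX' hZ)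
    have h2 := mvfderiv_add (g.mdifferentiableAt hX hY) (g.mdifferentiableAt hX' hY)
    have e1 : (fun y ↦ g.inner y ((X + X') y) (Z y)) =
        (fun y ↦ g.inner y (X y) (Z y)) + fun y ↦ g.inner y (X' y) (Z y) := by
      ext y; simp
    have e2 : (fun y ↦ g.inner y ((X + X') y) (Y y)) =
        (fun y ↦ g.inner y (X y) (Y y)) + fun y ↦ g.inner y (X' y) (Y y) := by
      ext y; simp
    simp only [koszul, e1, e2, h1, h2, mlieBracket_add_left hX hX']
    simp
    ring

theorem koszul_tensorial_right (g : SmoothMetric I M) {X Y : Π x : M, TangentSpace I x} {x : M}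
    (hX : MDiffAt (T% X) x) (hY : MDiffAt (T% Y) x) :
    TensorialAt I E (fun Z ↦ koszul g X Y Z x) x where
  smul {f Z} hf hZ := by
    have h1 := mvfderiv_mul hf (g.mdifferentiableAt hX hZ)
    have h2 := mvfderiv_mul hf (g.mdifferentiableAt hY hZ)
    have e1 : (fun y ↦ g.inner y (X y) ((f • Z) y)) = f * fun y ↦ g.inner y (X y) (Z y) := by
      ext y; simp
    have e2 : (fun y ↦ g.inner y (Y y) ((f • Z) y)) = f * fun y ↦ g.inner y (Y y) (Z y) := by
      ext y; simp
    simp only [koszul, e1, e2, h1, h2, mlieBracket_smul_right hf hZ]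
    simp [g.symm x (Z x) (X x), g.symm x (Z x) (Y x)]
    ring
  add {Z Z'} hZ hZ' := by
    have h1 := mvfderiv_add (g.mdifferentiableAt hX hZ) (g.mdifferentiableAt hX hZ')
    have h2 := mvfderiv_add (g.mdifferentiableAt hY hZ) (g.mdifferentiableAt hY hZ')
    have e1 : (fun y ↦ g.inner y (X y) ((Z + Z') y)) =
        (fun y ↦ g.inner y (X y) (Z y)) + fun y ↦ g.inner y (X y) (Z' y) := by
      ext y; simp
    have e2 : (fun y ↦ g.inner y (Y y) ((Z + Z') y)) =
        (fun y ↦ g.inner y (Y y) (Z y)) + fun y ↦ g.inner y (Y y) (Z' y) := by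
      ext y; simp
    simp only [koszul, e1, e2, h1, h2, mlieBracket_add_right hZ hZ']
    simp
    ring

/-- The metric at `x` as a bilinear form. -/
def SmoothMetric.bilin (g : SmoothMetric I M) (x : M) :
    LinearMap.BilinForm ℝ (TangentSpace I x) :=
  (ContinuousLinearMap.coeLM ℝ) ∘ₗ (g.inner x).toLinearMap

theorem SmoothMetric.bilin_nondegenerate (g : SmoothMetric I M) (x : M) :
    (g.bilin x).Nondegenerate := by
  have key : ∀ v : TangentSpace I x, g.inner x v v = 0 → v = 0 := fun v hv ↦ by
    by_contra h
    exact (g.pos x v h).ne' hv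
  exact ⟨fun v hv ↦ key v (hv v), fun v hv ↦ key v (hv v)⟩

instance tangentSpace_finiteDimensional (x : M) : FiniteDimensional ℝ (TangentSpace I x) :=
  inferInstanceAs (FiniteDimensional ℝ E)

instance tangentSpace_t2Space (x : M) : T2Space (TangentSpace I x) :=
  inferInstanceAs (T2Space E)

/-- The vector representing a linear functional on `T_xM`. -/
def SmoothMetric.sharp (g : SmoothMetric I M) (x : M) :
    Module.Dual ℝ (TangentSpace I x) ≃ₗ[ℝ] TangentSpace I x :=
  ((g.bilin x).toDual (g.bilin_nondegenerate x)).symm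

theorem SmoothMetric.inner_sharp (g : SmoothMetric I M) (x : M)
    (l : Module.Dual ℝ (TangentSpace I x)) (v : TangentSpace I x) :
    g.inner x (g.sharp x l) v = l v :=
  LinearMap.BilinForm.apply_toDual_symm_apply (hB := g.bilin_nondegenerate x) l v

theorem SmoothMetric.ext_inner (g : SmoothMetric I M) {x : M} {v w : TangentSpace I x}
    (h : ∀ u, g.inner x v u = g.inner x w u) : v = w := by
  by_contra hvw
  have := g.pos x (v - w) (sub_ne_zero.2 hvw)
  simp [h] at this

open Classical in
/-- `v ↦ ∇_v Y` at `x`, where `g(∇_v Y, w)` is given by the Koszul formula (and `0` by convention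
if `Y` is not differentiable at `x`). -/
def leviCivitaFun (g : SmoothMetric I M) (Y : Π x : M, TangentSpace I x) (x : M) :
    TangentSpace I x →L[ℝ] TangentSpace I x :=
  if hY : MDiffAt (T% Y) x then
    LinearMap.toContinuousLinearMap
      ((g.sharp x).toLinearMap ∘ₗ
        (ContinuousLinearMap.coeLM ℝ :
          (TangentSpace I x →L[ℝ] ℝ) →ₗ[ℝ] Module.Dual ℝ (TangentSpace I x)) ∘ₗ
        (TensorialAt.mkHom₂ (fun X Z ↦ koszul g X Y Z x) x
          (fun _ hZ ↦ koszul_tensorial_left g hY hZ)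
          (fun _ hX ↦ koszul_tensorial_right g hX hY)).toLinearMap)
  else 0

/-- The Koszul formula. -/
theorem inner_leviCivitaFun (g : SmoothMetric I M) {X Y Z : Π x : M, TangentSpace I x} {x : M}
    (hX : MDiffAt (T% X) x) (hY : MDiffAt (T% Y) x) (hZ : MDiffAt (T% Z) x) :
    g.inner x (leviCivitaFun g Y x (X x)) (Z x) = koszul g X Y Z x := by
  rw [leviCivitaFun, dif_pos hY]
  refine (g.inner_sharp x _ _).trans ?_
  exact TensorialAt.mkHom₂_apply (I := I) (F := E) (F' := E)
    (Φ := fun X Z ↦ koszul g X Y Z x)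
    (fun _ hZ ↦ koszul_tensorial_left g hY hZ)
    (fun _ hX ↦ koszul_tensorial_right g hX hY) hX hZ

theorem koszul_add_middle (g : SmoothMetric I M) {X Y Y' Z : Π x : M, TangentSpace I x} {x : M}
    (hX : MDiffAt (T% X) x) (hY : MDiffAt (T% Y) x) (hY' : MDiffAt (T% Y') x)
    (hZ : MDiffAt (T% Z) x) :
    koszul g X (Y + Y') Z x = koszul g X Y Z x + koszul g X Y' Z x := by
  have h1 := mvfderiv_add (g.mdifferentiableAt hY hZ) (g.mdifferentiableAt hY' hZ)
  have h2 := mvfderiv_add (g.mdifferentiableAt hX hY) (g.mdifferentiableAt hX hY')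
  have e1 : (fun y ↦ g.inner y ((Y + Y') y) (Z y)) =
      (fun y ↦ g.inner y (Y y) (Z y)) + fun y ↦ g.inner y (Y' y) (Z y) := by
    ext y; simp
  have e2 : (fun y ↦ g.inner y (X y) ((Y + Y') y)) =
      (fun y ↦ g.inner y (X y) (Y y)) + fun y ↦ g.inner y (X y) (Y' y) := by
    ext y; simp
  simp only [koszul, e1, e2, h1, h2, mlieBracket_add_left hY hY', mlieBracket_add_right hY hY']
  simp
  ring

theorem koszul_smul_middle (g : SmoothMetric I M) {X Y Z : Π x : M, TangentSpace I x} {x : M}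
    {f : M → ℝ} (hf : MDiffAt f x)
    (hX : MDiffAt (T% X) x) (hY : MDiffAt (T% Y) x) (hZ : MDiffAt (T% Z) x) :
    koszul g X (f • Y) Z x = f x * koszul g X Y Z x + d% f x (X x) * g.inner x (Y x) (Z x) := by
  have h1 := mvfderiv_mul hf (g.mdifferentiableAt hY hZ)
  have h2 := mvfderiv_mul hf (g.mdifferentiableAt hX hY)
  have e1 : (fun y ↦ g.inner y ((f • Y) y) (Z y)) = f * fun y ↦ g.inner y (Y y) (Z y) := by
    ext y; simp
  have e2 : (fun y ↦ g.inner y (X y) ((f • Y) y)) = f * fun y ↦ g.inner y (X y) (Y y) := by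
    ext y; simp
  simp only [koszul, e1, e2, h1, h2, mlieBracket_smul_left hf hY, mlieBracket_smul_right hf hY]
  simp [g.symm x (Y x) (X x)]
  ring

theorem isCovariantDerivativeOn_leviCivitaFun (g : SmoothMetric I M) :
    IsCovariantDerivativeOn E (leviCivitaFun g) Set.univ where
  add {Y Y' x} hY hY' _ := by
    ext1 v
    refine g.ext_inner fun w ↦ ?_
    have hX := FiberBundle.mdifferentiableAt_extend I E v
    have hZ := FiberBundle.mdifferentiableAt_extend I E w
    have h0 := inner_leviCivitaFun g hX (mdifferentiableAt_add_section hY hY') hZ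
    have h1 := inner_leviCivitaFun g hX hY hZ
    have h2 := inner_leviCivitaFun g hX hY' hZ
    rw [koszul_add_middle g hX hY hY' hZ, ← h1, ← h2] at h0
    simpa using h0
  leibniz {Y f x} hY hf _ := by
    ext1 v
    refine g.ext_inner fun w ↦ ?_
    have hX := FiberBundle.mdifferentiableAt_extend I E v
    have hZ := FiberBundle.mdifferentiableAt_extend I E w
    have h0 := inner_leviCivitaFun g hX (hf.smul_section hY) hZ
    have h1 := inner_leviCivitaFun g hX hY hZ
    rw [koszul_smul_middle g hf hX hY hZ, ← h1] at h0
    simpa using h0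

/-- The Levi-Civita connection of a smooth Riemannian metric. -/
def leviCivita (g : SmoothMetric I M) :
    CovariantDerivative I E (fun x : M ↦ TangentSpace I x) where
  toFun := leviCivitaFun g
  isCovariantDerivativeOnUniv := isCovariantDerivativeOn_leviCivitaFun g

theorem leviCivita_torsion (g : SmoothMetric I M) : (leviCivita g).torsion = 0 := by
  rw [CovariantDerivative.torsion_eq_zero_iff]
  intro X Y x hX hY
  refine g.ext_inner fun w ↦ ?_
  have hZ := FiberBundle.mdifferentiableAt_extend I E w
  have h1 := inner_leviCivitaFun g hX hY hZ
  have h2 := inner_leviCivitaFun g hY hX hZ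
  have e : (fun y ↦ g.inner y (Y y) (X y)) = fun y ↦ g.inner y (X y) (Y y) := by
    ext y; exact g.symm _ _ _
  rw [FiberBundle.extend_apply_self] at h1 h2
  change g.inner x (leviCivitaFun g Y x (X x) - leviCivitaFun g X x (Y x)) w = _
  rw [map_sub, sub_apply, h1, h2]
  simp only [koszul, e, mlieBracket_swap_apply (V := Y) (W := X)]
  simp
  ring

theorem leviCivita_metric (g : SmoothMetric I M) {X Y Z : Π x : M, TangentSpace I x} {x : M}
    (hX : MDiffAt (T% X) x) (hY : MDiffAt (T% Y) x) (hZ : MDiffAt (T% Z) x) :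
    d% (fun y ↦ g.inner y (Y y) (Z y)) x (X x) =
      g.inner x (leviCivita g Y x (X x)) (Z x) + g.inner x (Y x) (leviCivita g Z x (X x)) := by
  have h1 := inner_leviCivitaFun g hX hY hZ
  have h2 := inner_leviCivitaFun g hX hZ hY
  have e : (fun y ↦ g.inner y (Z y) (Y y)) = fun y ↦ g.inner y (Y y) (Z y) := by
    ext y; exact g.symm _ _ _
  rw [g.symm x (Y x)]
  change _ = g.inner x (leviCivitaFun g Y x (X x)) (Z x) + g.inner x (leviCivitaFun g Z x (X x)) _
  rw [h1, h2]
  simp only [koszul, e, mlieBracket_swap_apply (V := Z) (W := Y)]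
  simp
  ring

end LeviCivita
/-! ## Foliations and adapted metrics -/

section Foliation

variable {n : ℕ} {M : Type*} [TopologicalSpace M]
  [ChartedSpace (EuclideanSpace ℝ (Fin (n + 1))) M] [IsManifold (𝓡 (n + 1)) ∞ M]

/-- A smooth codimension-one foliation of the `(n+1)`-manifold `M`, given by its tangent
distribution `Tℱ`: around every point there is a smooth foliated chart, that is, a chart of `M` in
which `Tℱ` is the tangent distribution of the slices on which the last coordinate is constant. -/
structure CodimOneFoliation (n : ℕ) (M : Type*) [TopologicalSpace M]
    [ChartedSpace (EuclideanSpace ℝ (Fin (n + 1))) M] [IsManifold (𝓡 (n + 1)) ∞ M] where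
  tangent (x : M) : Submodule ℝ (TangentSpace (𝓡 (n + 1)) x)
  exists_foliatedChart (x : M) :
    ∃ φ ∈ IsManifold.maximalAtlas (𝓡 (n + 1)) ∞ M, x ∈ φ.source ∧
      ∀ y ∈ φ.source, ∀ v : TangentSpace (𝓡 (n + 1)) y,
        v ∈ tangent y ↔
          EuclideanSpace.proj (𝕜 := ℝ) (Fin.last n)
            (mfderiv (𝓡 (n + 1)) (𝓡 (n + 1)) φ y v : EuclideanSpace ℝ (Fin (n + 1))) = 0

/-- A Riemannian metric adapted to `(ℱ, N)`: `g(N, Tℱ) = 0` and `g(N, N) = 1`. -/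
structure AdaptedMetric (F : CodimOneFoliation n M)
    (N : Π x : M, TangentSpace (𝓡 (n + 1)) x) where
  toMetric : SmoothMetric (𝓡 (n + 1)) M
  inner_normal (x : M) (v : TangentSpace (𝓡 (n + 1)) x) (hv : v ∈ F.tangent x) :
    toMetric.inner x (N x) v = 0
  inner_normal_self (x : M) : toMetric.inner x (N x) (N x) = 1

namespace AdaptedMetric

variable {F : CodimOneFoliation n M} {N : Π x : M, TangentSpace (𝓡 (n + 1)) x}

/-- The `Tℱ`-component `v ↦ v̂ = v - g(N, v) N` of tangent vectors at `x`. -/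
def hat (g : AdaptedMetric F N) (x : M) :
    TangentSpace (𝓡 (n + 1)) x →ₗ[ℝ] TangentSpace (𝓡 (n + 1)) x :=
  LinearMap.id - (g.toMetric.inner x (N x)).toLinearMap.smulRight (N x)

theorem hat_apply (g : AdaptedMetric F N) (x : M) (v : TangentSpace (𝓡 (n + 1)) x) :
    g.hat x v = v - g.toMetric.inner x (N x) v • N x := rfl

theorem hat_mem (g : AdaptedMetric F N) (x : M) (v : TangentSpace (𝓡 (n + 1)) x) :
    g.hat x v ∈ F.tangent x := by
  obtain ⟨φ, -, hx, h⟩ := F.exists_foliatedChart x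
  set l : TangentSpace (𝓡 (n + 1)) x →ₗ[ℝ] ℝ :=
    (EuclideanSpace.proj (𝕜 := ℝ) (Fin.last n)).toLinearMap ∘ₗ
      (mfderiv (𝓡 (n + 1)) (𝓡 (n + 1)) φ x).toLinearMap with hl
  have h' : ∀ w, w ∈ F.tangent x ↔ l w = 0 := fun w ↦ h x hx w
  have hN : l (N x) ≠ 0 := fun h0 ↦ by
    have h1 := g.inner_normal x (N x) ((h' _).2 h0)
    rw [g.inner_normal_self x] at h1
    exact one_ne_zero h1
  have hw : v - (l v / l (N x)) • N x ∈ F.tangent x := by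
    rw [h', map_sub, map_smul, smul_eq_mul, div_mul_cancel₀ _ hN, sub_self]
  have h2 := g.inner_normal x _ hw
  rw [map_sub, map_smul, g.inner_normal_self x, smul_eq_mul, mul_one, sub_eq_zero] at h2
  rw [hat_apply, h2]
  exact hw

/-- The `ℱ`-truncated metric `ĝ(u, v) = g(û, v̂)`. -/
def truncated (g : AdaptedMetric F N) (x : M) (u v : TangentSpace (𝓡 (n + 1)) x) : ℝ :=
  g.toMetric.inner x (g.hat x u) (g.hat x v)

/-- The Weingarten operator `A(X) = -(∇_X N)^⊤` of the leaves, as an endomorphism of `T_xℱ`;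
here `∇` is the Levi-Civita connection of `g` on `M`. -/
def weingarten (g : AdaptedMetric F N) (x : M) : F.tangent x →ₗ[ℝ] F.tangent x :=
  LinearMap.codRestrict (F.tangent x)
    (-(g.hat x ∘ₗ (leviCivita g.toMetric N x).toLinearMap ∘ₗ (F.tangent x).subtype))
    (fun _ ↦ (F.tangent x).neg_mem (g.hat_mem x _))

/-- The principal curvatures of `ℱ` at `x`: the eigenvalues of the Weingarten operator on `T_xℱ`,
counted with multiplicity. -/
def principalCurvatures (g : AdaptedMetric F N) (x : M) : Multiset ℝ :=
  (g.weingarten x).charpoly.roots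

/-- The power sums `τ_j` of the principal curvatures. -/
def powerSum (g : AdaptedMetric F N) (j : ℕ) (x : M) : ℝ :=
  ((g.principalCurvatures x).map (fun k ↦ k ^ j)).sum

/-- The elementary symmetric functions `σ_j` of the principal curvatures. -/
def elemSymm (g : AdaptedMetric F N) (j : ℕ) (x : M) : ℝ :=
  (g.principalCurvatures x).esymm j

end AdaptedMetric

/-- `∂_t g_t = s_t ĝ_t` for `t` in `J` (one-sided at endpoints of `J` that belong to it). -/
def IsConformalVariation {F : CodimOneFoliation n M} {N : Π x : M, TangentSpace (𝓡 (n + 1)) x}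
    (J : Set ℝ) (g : ℝ → AdaptedMetric F N) (s : ℝ → M → ℝ) : Prop :=
  ∀ t ∈ J, ∀ (x : M) (u v : TangentSpace (𝓡 (n + 1)) x),
    HasDerivWithinAt (fun r ↦ (g r).toMetric.inner x u v) (s t x * (g t).truncated x u v) J t

end Foliation

/-! ## The polynomials `F_k` and `Ψ_k` -/

section Polynomials

open Polynomial
open scoped Nat

/-- `F_k = X^k / n^(k-1) + ∑_{i=2}^k (k! / (i! (k-i)!)) (φ_i / n^(k-i)) X^(k-i)` with `φ_i = c i`. -/
def powerSumPoly (n : ℕ) (c : ℕ → ℝ) (k : ℕ) : ℝ[X] :=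
  C (1 / (n : ℝ) ^ (k - 1)) * X ^ k +
    ∑ i ∈ Finset.Icc 2 k,
      C ((k ! : ℝ) / ((i ! : ℝ) * ((k - i)! : ℝ)) * (c i / (n : ℝ) ^ (k - i))) * X ^ (k - i)

/-- `Ψ_k = ((n-1)! / (k! (n-k)!)) X^k / n^(k-1)
  + ∑_{i=2}^k ((n-i)! / ((k-i)! (n-k)!)) (ψ_i / n^(k-i)) X^(k-i)` with `ψ_i = c i`, for `k ≤ n`. -/
def elemSymmPoly (n : ℕ) (c : ℕ → ℝ) (k : ℕ) : ℝ[X] :=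
  C (((n - 1)! : ℝ) / ((k ! : ℝ) * ((n - k)! : ℝ)) * (1 / (n : ℝ) ^ (k - 1))) * X ^ k +
    ∑ i ∈ Finset.Icc 2 k,
      C (((n - i)! : ℝ) / (((k - i)! : ℝ) * ((n - k)! : ℝ)) * (c i / (n : ℝ) ^ (k - i))) *
        X ^ (k - i)

/-- The coefficients `φ_k` obtained recursively from given power sums `p_1, p_2, …`:
`φ_k` is `p_k` minus all terms of `F_k(p_1)` except the last one, which is `φ_k`. -/
def phiOfPowerSums (n : ℕ) (p : ℕ → ℝ) (k : ℕ) : ℝ :=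
  p k - (1 / (n : ℝ) ^ (k - 1) * p 1 ^ k +
    ∑ i ∈ (Finset.Ico 2 k).attach,
      (k ! : ℝ) / ((i.1 ! : ℝ) * ((k - i.1)! : ℝ)) *
        (phiOfPowerSums n p i.1 / (n : ℝ) ^ (k - i.1)) * p 1 ^ (k - i.1))
termination_by k
decreasing_by exact (Finset.mem_Ico.1 i.2).2

/-- The coefficients `ψ_k` obtained recursively from given elementary symmetric functions
`e_1, e_2, …`: `ψ_k` is `e_k` minus all terms of `Ψ_k(e_1)` except the last one, which is `ψ_k`. -/
def psiOfElemSymm (n : ℕ) (e : ℕ → ℝ) (k : ℕ) : ℝ :=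
  e k - (((n - 1)! : ℝ) / ((k ! : ℝ) * ((n - k)! : ℝ)) * (1 / (n : ℝ) ^ (k - 1)) * e 1 ^ k +
    ∑ i ∈ (Finset.Ico 2 k).attach,
      ((n - i.1)! : ℝ) / (((k - i.1)! : ℝ) * ((n - k)! : ℝ)) *
        (psiOfElemSymm n e i.1 / (n : ℝ) ^ (k - i.1)) * e 1 ^ (k - i.1))
termination_by k
decreasing_by exact (Finset.mem_Ico.1 i.2).2

end Polynomials

section Coefficients

variable {n : ℕ} {M : Type*} [TopologicalSpace M]
  [ChartedSpace (EuclideanSpace ℝ (Fin (n + 1))) M] [IsManifold (𝓡 (n + 1)) ∞ M]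
  {F : CodimOneFoliation n M} {N : Π x : M, TangentSpace (𝓡 (n + 1)) x}

/-- The functions `φ_k` on `M` determined recursively by the power sums of the metric `g`. -/
def AdaptedMetric.phi (g : AdaptedMetric F N) (x : M) (k : ℕ) : ℝ :=
  phiOfPowerSums n (fun j ↦ g.powerSum j x) k

/-- The functions `ψ_k` on `M` determined recursively by the elementary symmetric functions of the
metric `g`. -/
def AdaptedMetric.psi (g : AdaptedMetric F N) (x : M) (k : ℕ) : ℝ :=
  psiOfElemSymm n (fun j ↦ g.elemSymm j x) k

end Coefficients

end

/-! ### Symmetric functions of a translated multiset of real numbers -/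

section Algebra

open Polynomial
open scoped Nat

/-! The variation translates all principal curvatures at a point by one common number, and the
theorem records how symmetric functions behave under translation.

Geometry. On `Tℱ` the variation reads `∂_t g_t = s_t g_t`, so at each point `g_t = ρ g_0` on `Tℱ`
with `ρ > 0` (`IsConformalVariation.exists_conformal_factor`), while the projection to `Tℱ` along
`N` is the same for all adapted metrics. For commuting sections `X`, `Y` of `Tℱ`, the Koszul formula
expresses `g(∇_X N, Y)` through `N(g(X, Y))` and the metric on `Tℱ` alone
(`inner_leviCivita_normal`). Scaling the metric by `ρ` there multiplies this by `ρ`, up to the extra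
term `N(ρ) g(X, Y) / 2`. Hence the Weingarten operator changes by `-N(ρ)/(2ρ)` times the identity
(`exists_weingarten_eq_add_smul`). It is self-adjoint, so there are `n` real principal curvatures,
and all are shifted equally.

Algebra. Expand the symmetric functions of a multiset around its mean `τ_1 / n`. The coefficients
are the symmetric functions of the centred multiset, and the term of index one drops out; this gives
`F_k` and `Ψ_k`. Centring absorbs translations, so the coefficients do not depend on `t`. The
recursions solve the same triangular system at `t = 0`, hence return these coefficients. -/

theorem eval_powerSumPoly (n : ℕ) (c : ℕ → ℝ) (k : ℕ) (y : ℝ) :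
    (powerSumPoly n c k).eval y = 1 / (n : ℝ) ^ (k - 1) * y ^ k +
      ∑ i ∈ Finset.Icc 2 k,
        (k ! : ℝ) / ((i ! : ℝ) * ((k - i)! : ℝ)) * (c i / (n : ℝ) ^ (k - i)) * y ^ (k - i) := by
  simp [powerSumPoly, eval_finsetSum]

theorem eval_elemSymmPoly (n : ℕ) (c : ℕ → ℝ) (k : ℕ) (y : ℝ) :
    (elemSymmPoly n c k).eval y =
      ((n - 1)! : ℝ) / ((k ! : ℝ) * ((n - k)! : ℝ)) * (1 / (n : ℝ) ^ (k - 1)) * y ^ k +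
      ∑ i ∈ Finset.Icc 2 k,
        ((n - i)! : ℝ) / (((k - i)! : ℝ) * ((n - k)! : ℝ)) * (c i / (n : ℝ) ^ (k - i)) *
          y ^ (k - i) := by
  simp [elemSymmPoly, eval_finsetSum]

theorem eval_zero_powerSumPoly (n : ℕ) (c : ℕ → ℝ) {k : ℕ} (hk : 2 ≤ k) :
    (powerSumPoly n c k).eval 0 = c k := by
  rw [eval_powerSumPoly, Finset.sum_eq_single k]
  · have : (k ! : ℝ) ≠ 0 := by positivity
    simp [show k ≠ 0 by omega, this]
  · intro i hi hik
    rw [zero_pow (by grind), mul_zero]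
  · grind

theorem eval_zero_elemSymmPoly (n : ℕ) (c : ℕ → ℝ) {k : ℕ} (hk : 2 ≤ k) :
    (elemSymmPoly n c k).eval 0 = c k := by
  rw [eval_elemSymmPoly, Finset.sum_eq_single k]
  · have : ((n - k)! : ℝ) ≠ 0 := by positivity
    simp [show k ≠ 0 by omega, this]
  · intro i hi hik
    rw [zero_pow (by grind), mul_zero]
  · grind

theorem phiOfPowerSums_eq (n : ℕ) (p : ℕ → ℝ) (k : ℕ) :
    phiOfPowerSums n p k = p k - (1 / (n : ℝ) ^ (k - 1) * p 1 ^ k +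
      ∑ i ∈ Finset.Ico 2 k, (k ! : ℝ) / ((i ! : ℝ) * ((k - i)! : ℝ)) *
        (phiOfPowerSums n p i / (n : ℝ) ^ (k - i)) * p 1 ^ (k - i)) := by
  rw [phiOfPowerSums, Finset.sum_attach (Finset.Ico 2 k) (fun i ↦
    (k ! : ℝ) / ((i ! : ℝ) * ((k - i)! : ℝ)) *
        (phiOfPowerSums n p i / (n : ℝ) ^ (k - i)) * p 1 ^ (k - i))]

theorem psiOfElemSymm_eq (n : ℕ) (e : ℕ → ℝ) (k : ℕ) :
    psiOfElemSymm n e k =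
      e k - (((n - 1)! : ℝ) / ((k ! : ℝ) * ((n - k)! : ℝ)) * (1 / (n : ℝ) ^ (k - 1)) * e 1 ^ k +
      ∑ i ∈ Finset.Ico 2 k, ((n - i)! : ℝ) / (((k - i)! : ℝ) * ((n - k)! : ℝ)) *
        (psiOfElemSymm n e i / (n : ℝ) ^ (k - i)) * e 1 ^ (k - i)) := by
  rw [psiOfElemSymm, Finset.sum_attach (Finset.Ico 2 k) (fun i ↦
    ((n - i)! : ℝ) / (((k - i)! : ℝ) * ((n - k)! : ℝ)) *
        (psiOfElemSymm n e i / (n : ℝ) ^ (k - i)) * e 1 ^ (k - i))]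

/-- If `p_k = F_k(p_1)` for some coefficients, these are the recursively defined ones. -/
theorem phiOfPowerSums_eq_of_eval {n : ℕ} {p q : ℕ → ℝ}
    (h : ∀ k, 2 ≤ k → p k = (powerSumPoly n q k).eval (p 1)) {k : ℕ} (hk : 2 ≤ k) :
    phiOfPowerSums n p k = q k := by
  induction k using Nat.strong_induction_on with
  | _ k ih =>
    -- The term `i = k` of the sum is `q k` itself, so subtracting all the others isolates it once
    -- the lower coefficients agree.
    rw [phiOfPowerSums_eq, h k hk, eval_powerSumPoly, ← Finset.Ico_insert_right hk,
      Finset.sum_insert (by simp)]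
    have hs : ∑ i ∈ Finset.Ico 2 k, (k ! : ℝ) / ((i ! : ℝ) * ((k - i)! : ℝ)) *
        (phiOfPowerSums n p i / (n : ℝ) ^ (k - i)) * p 1 ^ (k - i) =
        ∑ i ∈ Finset.Ico 2 k, (k ! : ℝ) / ((i ! : ℝ) * ((k - i)! : ℝ)) *
        (q i / (n : ℝ) ^ (k - i)) * p 1 ^ (k - i) :=
      Finset.sum_congr rfl fun i hi ↦ by
        rw [ih i (Finset.mem_Ico.1 hi).2 (Finset.mem_Ico.1 hi).1]
    have : (k ! : ℝ) ≠ 0 := by positivity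
    rw [hs]
    simp [this]

/-- If `e_k = Ψ_k(e_1)` for some coefficients, these are the recursively defined ones. -/
theorem psiOfElemSymm_eq_of_eval {n : ℕ} {e q : ℕ → ℝ}
    (h : ∀ k, 2 ≤ k → k ≤ n → e k = (elemSymmPoly n q k).eval (e 1)) {k : ℕ} (hk : 2 ≤ k)
    (hkn : k ≤ n) : psiOfElemSymm n e k = q k := by
  induction k using Nat.strong_induction_on with
  | _ k ih =>
    rw [psiOfElemSymm_eq, h k hk hkn, eval_elemSymmPoly, ← Finset.Ico_insert_right hk,
      Finset.sum_insert (by simp)]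
    have hs : ∑ i ∈ Finset.Ico 2 k, ((n - i)! : ℝ) / (((k - i)! : ℝ) * ((n - k)! : ℝ)) *
        (psiOfElemSymm n e i / (n : ℝ) ^ (k - i)) * e 1 ^ (k - i) =
        ∑ i ∈ Finset.Ico 2 k, ((n - i)! : ℝ) / (((k - i)! : ℝ) * ((n - k)! : ℝ)) *
        (q i / (n : ℝ) ^ (k - i)) * e 1 ^ (k - i) :=
      Finset.sum_congr rfl fun i hi ↦ by
        rw [ih i (Finset.mem_Ico.1 hi).2 (Finset.mem_Ico.1 hi).1
          ((Finset.mem_Ico.1 hi).2.le.trans hkn)]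
    have : ((n - k)! : ℝ) ≠ 0 := by positivity
    rw [hs]
    simp [this]

/-- Needed because the recursive coefficients are identified with the central moments only from
index two on. -/
theorem powerSumPoly_congr {n : ℕ} {c c' : ℕ → ℝ} {k : ℕ}
    (h : ∀ i, 2 ≤ i → i ≤ k → c i = c' i) : powerSumPoly n c k = powerSumPoly n c' k := by
  unfold powerSumPoly
  congr 1
  exact Finset.sum_congr rfl fun i hi ↦ by
    rw [h i (Finset.mem_Icc.1 hi).1 (Finset.mem_Icc.1 hi).2]

theorem elemSymmPoly_congr {n : ℕ} {c c' : ℕ → ℝ} {k : ℕ}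
    (h : ∀ i, 2 ≤ i → i ≤ k → c i = c' i) : elemSymmPoly n c k = elemSymmPoly n c' k := by
  unfold elemSymmPoly
  congr 1
  exact Finset.sum_congr rfl fun i hi ↦ by
    rw [h i (Finset.mem_Icc.1 hi).1 (Finset.mem_Icc.1 hi).2]

/-- The binomial expansion of the power sums of a translated multiset. -/
theorem Multiset.sum_map_add_pow (s : Multiset ℝ) (m : ℝ) (k : ℕ) :
    (s.map fun r ↦ (r + m) ^ k).sum =
      ∑ i ∈ Finset.range (k + 1), k.choose i * m ^ (k - i) * (s.map (· ^ i)).sum := by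
  induction s using Multiset.induction_on with
  | empty => simp
  | cons a s ih =>
    simp only [Multiset.map_cons, Multiset.sum_cons, ih, mul_add, Finset.sum_add_distrib]
    rw [add_pow]
    congr 1
    exact Finset.sum_congr rfl fun i _ ↦ by ring

theorem Multiset.esymm_one_eq_sum (s : Multiset ℝ) : s.esymm 1 = s.sum := by
  simp [Multiset.esymm, Multiset.powersetCard_one, Multiset.map_map]

/-- The elementary symmetric functions of a translated multiset. -/
theorem Multiset.esymm_map_add (s : Multiset ℝ) (m : ℝ) {k : ℕ} (hk : k ≤ card s) :
    (s.map (· + m)).esymm k =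
      ∑ i ∈ Finset.range (k + 1),
        (card s - i).choose (k - i) * m ^ (k - i) * s.esymm i := by
  -- Vieta: compare coefficients of `X ^ (card s - k)` in `∏ (X + r + m)`, which is `∏ (X + r)`
  -- composed with `X + m`.
  have h1 := Multiset.prod_X_add_C_coeff (s.map (· + m)) (k := card s - k)
    (by rw [card_map]; exact Nat.sub_le _ _)
  rw [card_map, Nat.sub_sub_self hk] at h1
  have h2 : (((s.map (· + m)).map fun r => X + C r).prod : ℝ[X]) =
      ((s.map fun r => X + C r).prod).comp (X + C m) := by
    rw [Polynomial.multiset_prod_comp, Multiset.map_map, Multiset.map_map]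
    congr 1
    refine Multiset.map_congr rfl fun r _ ↦ ?_
    simp
    ring
  rw [← h1, h2, Multiset.prod_X_add_C_eq_sum_esymm, Polynomial.sum_comp, finsetSum_coeff]
  have h3 : ∀ i, ((C (s.esymm i) * X ^ (card s - i)).comp (X + C m)).coeff (card s - k) =
      (card s - i).choose (card s - k) * m ^ (card s - i - (card s - k)) * s.esymm i := by
    intro i
    simp [coeff_X_add_C_pow]
    ring
  simp only [h3]
  symm
  -- The expanded product sums over all `i ≤ card s`; for `i > k` the binomial coefficient vanishes.
  refine Finset.sum_subset_zero_on_sdiff (by grind) (fun i hi ↦ ?_) (fun i hi ↦ ?_)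
  · rw [Nat.choose_eq_zero_of_lt (by grind)]
    simp
  · have hi : i ≤ k := by grind
    rw [show card s - i - (card s - k) = k - i by omega,
      ← Nat.choose_symm_of_eq_add (show card s - i = (card s - k) + (k - i) by omega)]

variable {n : ℕ}

/-- This is why the sums in `F_k` and `Ψ_k` start at `i = 2`. -/
theorem Multiset.sum_map_sub_mean (hn : n ≠ 0) {s : Multiset ℝ} (hs : card s = n) :
    (s.map (· - s.sum / n)).sum = 0 := by
  have hn' : (n : ℝ) ≠ 0 := by exact_mod_cast hn
  simp [Multiset.sum_map_sub, hs]
  field_simp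
  simp

/-- The power sums in terms of the first one and the central moments. -/
theorem Multiset.sum_map_pow_eq_eval (hn : n ≠ 0) {s : Multiset ℝ} (hs : card s = n) {k : ℕ}
    (hk : 1 ≤ k) :
    (s.map (· ^ k)).sum =
      (powerSumPoly n (fun i ↦ ((s.map (· - s.sum / n)).map (· ^ i)).sum) k).eval s.sum := by
  have hn' : (n : ℝ) ≠ 0 := by exact_mod_cast hn
  set m := s.sum / n with hm
  -- `s` is its centred multiset translated back by the mean. In the expansion, index 0 gives `n m^k
  -- = y^k / n^(k-1)` with `y = s.sum`, and index 1 vanishes.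
  have h := Multiset.sum_map_add_pow (s.map (· - m)) m k
  rw [Multiset.map_map] at h
  simp only [Function.comp_def, sub_add_cancel] at h
  have hr : Finset.range (k + 1) = insert 0 (insert 1 (Finset.Icc 2 k)) := by grind
  have h1 : ((s.map (· - m)).map (· ^ 1)).sum = 0 := by
    simpa using Multiset.sum_map_sub_mean hn hs
  rw [h, hr, Finset.sum_insert (by grind), Finset.sum_insert (by grind), h1, eval_powerSumPoly,
    mul_zero, zero_add]
  congr 1
  · obtain ⟨k, rfl⟩ := Nat.exists_eq_add_of_le' hk
    simp [hs, hm, div_pow]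
    field_simp
    ring
  · refine Finset.sum_congr rfl fun i hi ↦ ?_
    rw [Nat.cast_choose ℝ (Finset.mem_Icc.1 hi).2, hm, div_pow]
    ring

/-- The elementary symmetric functions in terms of the first one and those of the centred
multiset. -/
theorem Multiset.esymm_eq_eval (hn : n ≠ 0) {s : Multiset ℝ} (hs : card s = n) {k : ℕ}
    (hk : 1 ≤ k) (hkn : k ≤ n) :
    s.esymm k = (elemSymmPoly n (fun i ↦ (s.map (· - s.sum / n)).esymm i) k).eval s.sum := by
  have hn' : (n : ℝ) ≠ 0 := by exact_mod_cast hn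
  set m := s.sum / n with hm
  have h := Multiset.esymm_map_add (s.map (· - m)) m (k := k) (by rwa [card_map, hs])
  rw [Multiset.map_map] at h
  simp only [Function.comp_def, sub_add_cancel, Multiset.map_id'] at h
  have hr : Finset.range (k + 1) = insert 0 (insert 1 (Finset.Icc 2 k)) := by grind
  have h1 : (s.map (· - m)).esymm 1 = 0 := by
    rw [Multiset.esymm_one_eq_sum]
    exact Multiset.sum_map_sub_mean hn hs
  rw [h, hr, Finset.sum_insert (by grind), Finset.sum_insert (by grind), h1, eval_elemSymmPoly,
    mul_zero, zero_add, card_map, hs]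
  congr 1
  -- Leading term: `n.choose k * m ^ k`, where one factor `n` of `n!` cancels against `n ^ k`.
  · obtain ⟨k, rfl⟩ := Nat.exists_eq_add_of_le' hk
    obtain ⟨n, rfl⟩ := Nat.exists_eq_succ_of_ne_zero hn
    rw [Nat.sub_zero, Nat.sub_zero, Nat.cast_choose ℝ hkn, hm, div_pow, Nat.factorial_succ n]
    simp [Multiset.esymm]
    field_simp
    ring
  · refine Finset.sum_congr rfl fun i hi ↦ ?_
    have hi := (Finset.mem_Icc.1 hi).2
    rw [Nat.cast_choose ℝ (by omega), show n - i - (k - i) = n - k by omega, hm, div_pow]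
    ring

/-- The mean moves along with the points. This is the source of the `t`-independence of `φ_i` and
`ψ_i`. -/
theorem Multiset.map_sub_mean_map_add (hn : n ≠ 0) {s : Multiset ℝ} (hs : card s = n) (c : ℝ) :
    (s.map (· + c)).map (· - (s.map (· + c)).sum / n) = s.map (· - s.sum / n) := by
  have hn' : (n : ℝ) ≠ 0 := by exact_mod_cast hn
  rw [Multiset.map_map]
  refine Multiset.map_congr rfl fun r _ ↦ ?_
  simp [Multiset.sum_map_add, hs]
  field_simp
  ring

/-- Power sums of a translate of `s`, with the coefficients determined by `s`. -/
theorem Multiset.sum_map_pow_map_add (hn : n ≠ 0) {s : Multiset ℝ} (hs : card s = n) (c : ℝ)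
    {k : ℕ} (hk : 1 ≤ k) :
    ((s.map (· + c)).map (· ^ k)).sum =
      (powerSumPoly n (phiOfPowerSums n fun j ↦ (s.map (· ^ j)).sum) k).eval
        (s.map (· + c)).sum := by
  rw [Multiset.sum_map_pow_eq_eval hn (by rwa [card_map]) hk, map_sub_mean_map_add hn hs]
  congr 1
  -- The central moments satisfy the system defining the recursion for `s`, so they are its
  -- solution.
  refine powerSumPoly_congr fun i hi _ ↦ (phiOfPowerSums_eq_of_eval
    (q := fun i ↦ ((s.map (· - s.sum / n)).map (· ^ i)).sum) (fun j hj ↦ ?_) hi).symm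
  simpa using Multiset.sum_map_pow_eq_eval hn hs (by omega : 1 ≤ j)

/-- Elementary symmetric functions of a translate of `s`, with the coefficients determined by
`s`. -/
theorem Multiset.esymm_map_add_eq_eval (hn : n ≠ 0) {s : Multiset ℝ} (hs : card s = n) (c : ℝ)
    {k : ℕ} (hk : 1 ≤ k) (hkn : k ≤ n) :
    (s.map (· + c)).esymm k =
      (elemSymmPoly n (psiOfElemSymm n s.esymm) k).eval ((s.map (· + c)).esymm 1) := by
  rw [Multiset.esymm_eq_eval hn (by rwa [card_map]) hk hkn, map_sub_mean_map_add hn hs,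
    Multiset.esymm_one_eq_sum]
  congr 1
  refine elemSymmPoly_congr fun i hi hik ↦
    (psiOfElemSymm_eq_of_eval (q := (s.map (· - s.sum / n)).esymm)
      (fun j hj hjn ↦ ?_) hi (hik.trans hkn)).symm
  rw [Multiset.esymm_one_eq_sum]
  exact Multiset.esymm_eq_eval hn hs (by omega) hjn

theorem eval_powerSumPoly_two (c : ℕ → ℝ) (y : ℝ) :
    (powerSumPoly n c 2).eval y = 1 / (n : ℝ) * y ^ 2 + c 2 := by
  rw [eval_powerSumPoly]
  simp

theorem eval_powerSumPoly_three (c : ℕ → ℝ) (y : ℝ) :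
    (powerSumPoly n c 3).eval y = 1 / (n : ℝ) ^ 2 * y ^ 3 + 3 / (n : ℝ) * c 2 * y + c 3 := by
  rw [eval_powerSumPoly, show Finset.Icc 2 3 = {2, 3} from rfl]
  simp [Nat.factorial]
  ring

theorem eval_powerSumPoly_four (c : ℕ → ℝ) (y : ℝ) :
    (powerSumPoly n c 4).eval y = 1 / (n : ℝ) ^ 3 * y ^ 4 + 6 / (n : ℝ) ^ 2 * c 2 * y ^ 2 +
      4 / (n : ℝ) * c 3 * y + c 4 := by
  rw [eval_powerSumPoly, show Finset.Icc 2 4 = {2, 3, 4} from rfl]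
  simp [Nat.factorial]
  ring

theorem eval_elemSymmPoly_two (hn : 2 ≤ n) (c : ℕ → ℝ) (y : ℝ) :
    (elemSymmPoly n c 2).eval y = ((n : ℝ) - 1) / (2 * (n : ℝ)) * y ^ 2 + c 2 := by
  obtain ⟨n, rfl⟩ := Nat.exists_eq_add_of_le' hn
  have := Nat.factorial_ne_zero n
  rw [eval_elemSymmPoly, show n + 2 - 1 = n + 1 by omega, Nat.factorial_succ n]
  simp
  field_simp
  ring

theorem eval_elemSymmPoly_three (hn : 3 ≤ n) (c : ℕ → ℝ) (y : ℝ) :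
    (elemSymmPoly n c 3).eval y =
      ((n : ℝ) - 1) * ((n : ℝ) - 2) / (6 * (n : ℝ) ^ 2) * y ^ 3 +
        ((n : ℝ) - 2) / (n : ℝ) * c 2 * y + c 3 := by
  obtain ⟨n, rfl⟩ := Nat.exists_eq_add_of_le' hn
  have := Nat.factorial_ne_zero n
  rw [eval_elemSymmPoly, show Finset.Icc 2 3 = {2, 3} from rfl,
    Finset.sum_insert (by simp), Finset.sum_singleton,
    show n + 3 - 1 = n + 1 + 1 by omega, show n + 3 - 2 = n + 1 by omega,
    Nat.factorial_succ (n + 1), Nat.factorial_succ n]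
  simp [Nat.factorial]
  field_simp
  ring

end Algebra

/-! ### Self-adjoint operators and shifts by scalars -/

section LinearAlgebra

open Polynomial

/-- An operator symmetric with respect to a positive definite form has a split characteristic
polynomial. -/
theorem LinearMap.charpoly_splits_of_symmetric {V : Type*} [AddCommGroup V] [Module ℝ V]
    [FiniteDimensional ℝ V] (B : V →ₗ[ℝ] V →ₗ[ℝ] ℝ) (hsymm : ∀ v w, B v w = B w v)
    (hpos : ∀ v, v ≠ 0 → 0 < B v v) (A : V →ₗ[ℝ] V) (hA : ∀ v w, B (A v) w = B v (A w)) :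
    A.charpoly.Splits := by
  let core : InnerProductSpace.Core ℝ V :=
    { inner := fun v w ↦ B v w
      conj_inner_symm := fun v w ↦ hsymm w v
      re_inner_nonneg := fun v ↦ by
        rcases eq_or_ne v 0 with rfl | hv
        · simp
        · simpa using (hpos v hv).le
      add_left := fun v w u ↦ by simp
      smul_left := fun v w c ↦ by simp
      definite := fun v h ↦ by
        by_contra hv
        exact (hpos v hv).ne' h }
  let _ : NormedAddCommGroup V := core.toNormedAddCommGroup
  let _ : InnerProductSpace ℝ V := InnerProductSpace.ofCore core.toCore
  exact LinearMap.IsSymmetric.splits_charpoly (T := A) hA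

/-- The characteristic polynomial of `A + c` is that of `A` composed with `X - c`. Splitting makes
it a product of factors `X - r`, each of which becomes `X - (r + c)`. -/
theorem LinearMap.roots_charpoly_add_smul {V : Type*} [AddCommGroup V] [Module ℝ V]
    [FiniteDimensional ℝ V] {A : V →ₗ[ℝ] V} (hA : A.charpoly.Splits) (c : ℝ) :
    (A + c • LinearMap.id).charpoly.roots = A.charpoly.roots.map (· + c) := by
  have h := LinearMap.charpoly_sub_smul A (-c)
  rw [neg_smul, sub_neg_eq_add] at h
  change (LinearMap.charpoly (A + c • (1 : Module.End ℝ V))).roots = _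
  rw [h]
  conv_lhs => rw [hA.eq_prod_roots_of_monic A.charpoly_monic, Polynomial.multiset_prod_comp,
    Multiset.map_map]
  rw [← Polynomial.roots_multiset_prod_X_sub_C (A.charpoly.roots.map (· + c)), Multiset.map_map]
  congr 2
  refine Multiset.map_congr rfl fun r _ ↦ ?_
  simp
  ring

end LinearAlgebra

/-! ### Local sections of the foliation adapted to a chart -/

section Foliation

open Filter Topology

/-- Differentiability at `x` of a vector field on a manifold. -/
abbrev MDifferentiableVectorFieldAt {E : Type*} [NormedAddCommGroup E] [NormedSpace ℝ E]
    {H : Type*} [TopologicalSpace H] (I : ModelWithCorners ℝ E H) {M : Type*} [TopologicalSpace M]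
    [ChartedSpace H M] [IsManifold I ∞ M] (X : Π x : M, TangentSpace I x) (x : M) : Prop :=
  MDiffAt (T% X) x

variable {n : ℕ} {M : Type*} [TopologicalSpace M]
  [ChartedSpace (EuclideanSpace ℝ (Fin (n + 1))) M] [IsManifold (𝓡 (n + 1)) ∞ M]

theorem lieBracketWithin_const {E : Type*} [NormedAddCommGroup E] [NormedSpace ℝ E] (a b : E)
    (s : Set E) (x : E) : lieBracketWithin ℝ (fun _ ↦ a) (fun _ ↦ b) s x = 0 := by
  simp [lieBracketWithin]

theorem Filter.EventuallyEq.mvfderiv_eq {E : Type*} [NormedAddCommGroup E] [NormedSpace ℝ E]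
    {H : Type*} [TopologicalSpace H] {I : ModelWithCorners ℝ E H} {M : Type*} [TopologicalSpace M]
    [ChartedSpace H M] {f f' : M → ℝ} {x : M} (h : f =ᶠ[𝓝 x] f') :
    mvfderiv I f x = mvfderiv I f' x := by
  ext v
  exact DFunLike.congr_fun (h.mfderiv_eq (I := I) (I' := 𝓘(ℝ, ℝ))) v

/-- The leafwise coordinate fields of a foliated chart extend the tangent vectors of the leaf to
commuting local sections of `Tℱ`. -/
theorem CodimOneFoliation.exists_commuting_extension (F : CodimOneFoliation n M) (x : M) :
    ∃ ext : TangentSpace (𝓡 (n + 1)) x → Π y : M, TangentSpace (𝓡 (n + 1)) y,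
      (∀ v, ext v x = v) ∧ (∀ v, MDifferentiableVectorFieldAt (𝓡 (n + 1)) (ext v) x) ∧
      (∀ v ∈ F.tangent x, ∀ᶠ y in 𝓝 x, ext v y ∈ F.tangent y) ∧
      ∀ v w, mlieBracket (𝓡 (n + 1)) (ext v) (ext w) x = 0 := by
  obtain ⟨φ, hφ, hx, h⟩ := F.exists_foliatedChart x
  have hsm : ContMDiffAt (𝓡 (n + 1)) (𝓡 (n + 1)) ∞ φ x :=
    contMDiffAt_of_mem_maximalAtlas hφ hx
  have hle : (2 : WithTop ℕ∞) ≤ ∞ := WithTop.coe_le_coe.2 (le_top : (2 : ℕ∞) ≤ ⊤)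
  have : IsManifold (𝓡 (n + 1)) (minSmoothness ℝ 2) M := by
    rw [minSmoothness_of_isRCLikeNormedField]
    infer_instance
  have : IsManifold (𝓡 (n + 1)) (minSmoothness ℝ 3) M := by
    rw [minSmoothness_of_isRCLikeNormedField]
    infer_instance
  have hmd : φ.MDifferentiable (𝓡 (n + 1)) (𝓡 (n + 1)) :=
    ⟨(contMDiffOn_of_mem_maximalAtlas hφ).mdifferentiableOn (by simp),
      (contMDiffOn_symm_of_mem_maximalAtlas hφ).mdifferentiableOn (by simp)⟩
  have hinv : ∀ y ∈ φ.source, (mfderiv (𝓡 (n + 1)) (𝓡 (n + 1)) φ y).IsInvertible :=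
    fun y hy ↦ ⟨hmd.mfderiv hy, rfl⟩
  -- The extensions are pullbacks of constant fields in the chart. Constant fields commute, and one
  -- whose last component is zero stays tangent to the slices everywhere.
  let cst (v : TangentSpace (𝓡 (n + 1)) x) :
      Π z : EuclideanSpace ℝ (Fin (n + 1)), TangentSpace (𝓡 (n + 1)) z :=
    fun _ ↦ mfderiv (𝓡 (n + 1)) (𝓡 (n + 1)) φ x v
  have hcst : ∀ v z, MDifferentiableVectorFieldAt (𝓡 (n + 1)) (cst v) z := fun v z ↦ by
    unfold MDifferentiableVectorFieldAt
    rw [mdifferentiableAt_totalSpace]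
    refine ⟨mdifferentiableAt_id, ?_⟩
    simpa [cst] using! mdifferentiableAt_const
  refine ⟨fun v ↦ mpullback (𝓡 (n + 1)) (𝓡 (n + 1)) φ (cst v), fun v ↦ ?_, fun v ↦ ?_,
    fun v hv ↦ ?_, fun v w ↦ ?_⟩
  · exact (hinv x hx).inverse_apply_eq.2 rfl
  · exact (hcst v _).mpullback_vectorField hsm (hinv x hx) hle
  · filter_upwards [φ.open_source.mem_nhds hx] with y hy
    rw [h y hy, mpullback_apply]
    have e : mfderiv (𝓡 (n + 1)) (𝓡 (n + 1)) φ y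
        ((mfderiv (𝓡 (n + 1)) (𝓡 (n + 1)) φ y).inverse (cst v (φ y))) = cst v (φ y) :=
      ((hinv y hy).inverse_apply_eq.1 rfl).symm
    rw [e]
    exact (h x hx v).1 hv
  · have h1 := mpullback_mlieBracket (hcst v (φ x)) (hcst w (φ x)) hsm (by simpa using hle)
    have h2 : mlieBracket (𝓡 (n + 1)) (cst v) (cst w) (φ x) = 0 := by
      rw [← mlieBracketWithin_univ]
      rw [mlieBracketWithin_eq_lieBracketWithin]
      exact lieBracketWithin_const (E := EuclideanSpace ℝ (Fin (n + 1))) _ _ _ _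
    rw [← h1, mpullback_apply, h2, map_zero]

/-! ### The Weingarten operator and its change under leafwise conformal scaling -/

namespace AdaptedMetric

variable {F : CodimOneFoliation n M} {N : Π x : M, TangentSpace (𝓡 (n + 1)) x}

theorem hat_of_mem (g : AdaptedMetric F N) {x : M} {v : TangentSpace (𝓡 (n + 1)) x}
    (hv : v ∈ F.tangent x) : g.hat x v = v := by
  rw [hat_apply, g.inner_normal x v hv, zero_smul, sub_zero]

theorem inner_hat (g : AdaptedMetric F N) {x : M} (v : TangentSpace (𝓡 (n + 1)) x)
    {w : TangentSpace (𝓡 (n + 1)) x} (hw : w ∈ F.tangent x) :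
    g.toMetric.inner x (g.hat x v) w = g.toMetric.inner x v w := by
  rw [hat_apply, map_sub, map_smul]
  simp [g.inner_normal x w hw]

/-- Both functionals vanish on `Tℱ` and equal 1 at `N`, and these span the tangent space. Hence the
projection to `Tℱ` does not depend on the adapted metric. -/
theorem inner_normal_eq (g g' : AdaptedMetric F N) (x : M) (v : TangentSpace (𝓡 (n + 1)) x) :
    g.toMetric.inner x (N x) v = g'.toMetric.inner x (N x) v := by
  have h := g.inner_normal x _ (g'.hat_mem x v)
  rw [hat_apply, map_sub, map_smul, g.inner_normal_self, smul_eq_mul, mul_one] at h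
  exact sub_eq_zero.1 h

theorem hat_eq (g g' : AdaptedMetric F N) (x : M) (v : TangentSpace (𝓡 (n + 1)) x) :
    g.hat x v = g'.hat x v := by
  rw [hat_apply, hat_apply, inner_normal_eq g g']

/-- `T_xℱ` is the kernel of the non-zero functional `g(N, ·)` in dimension `n + 1`. -/
theorem finrank_tangent (g : AdaptedMetric F N) (x : M) :
    Module.finrank ℝ (F.tangent x) = n := by
  have hker : F.tangent x = LinearMap.ker (g.toMetric.inner x (N x)).toLinearMap := by
    ext v
    refine ⟨fun hv ↦ g.inner_normal x v hv, fun hv ↦ ?_⟩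
    have := g.hat_mem x v
    rwa [hat_apply, show g.toMetric.inner x (N x) v = 0 from hv, zero_smul, sub_zero] at this
  have hne : (g.toMetric.inner x (N x)).toLinearMap ≠ 0 := fun h ↦ by
    have h1 := g.inner_normal_self x
    rw [show g.toMetric.inner x (N x) (N x) = 0 from LinearMap.congr_fun h (N x)] at h1
    exact zero_ne_one h1
  have h1 := LinearMap.finrank_range_add_finrank_ker (g.toMetric.inner x (N x)).toLinearMap
  rw [LinearMap.range_eq_top.2 (LinearMap.surjective hne), finrank_top, ← hker] at h1
  have h2 : Module.finrank ℝ (TangentSpace (𝓡 (n + 1)) x) = n + 1 :=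
    finrank_euclideanSpace_fin
  rw [h2] at h1
  simp at h1
  omega

/-- The Koszul formula for `g(∇_X N, Y)` with `X`, `Y` commuting local sections of `Tℱ`. -/
theorem inner_leviCivita_normal (g : AdaptedMetric F N) {x : M} (hN : MDifferentiableVectorFieldAt (𝓡 (n + 1)) N x)
    {X Y : Π y : M, TangentSpace (𝓡 (n + 1)) y} (hX : MDifferentiableVectorFieldAt (𝓡 (n + 1)) X x) (hY : MDifferentiableVectorFieldAt (𝓡 (n + 1)) Y x)
    (hXF : ∀ᶠ y in 𝓝 x, X y ∈ F.tangent y) (hYF : ∀ᶠ y in 𝓝 x, Y y ∈ F.tangent y)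
    (hXY : mlieBracket (𝓡 (n + 1)) X Y x = 0) :
    g.toMetric.inner x (leviCivita g.toMetric N x (X x)) (Y x) =
      1 / 2 * (mvfderiv (𝓡 (n + 1)) (fun y ↦ g.toMetric.inner y (X y) (Y y)) x (N x)
        + g.toMetric.inner x (g.hat x (mlieBracket (𝓡 (n + 1)) X N x)) (Y x)
        + g.toMetric.inner x (g.hat x (mlieBracket (𝓡 (n + 1)) Y N x)) (X x)) := by
  -- `g(N, Y)` and `g(X, N)` vanish near `x`, not just at `x`, so the derivative of `g(X, Y)` along
  -- `N` is the only one left in the Koszul formula.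
  have zero_of_eventually : ∀ f : M → ℝ, (∀ᶠ y in 𝓝 x, f y = 0) → mvfderiv (𝓡 (n + 1)) f x = 0 := by
    intro f hf
    have h1 : f =ᶠ[𝓝 x] fun _ ↦ (0 : ℝ) := hf
    rw [← mvfderiv_const (I := 𝓡 (n + 1)) (0 : ℝ) (x := x)]
    exact h1.mvfderiv_eq
  have h1 : mvfderiv (𝓡 (n + 1)) (fun y ↦ g.toMetric.inner y (N y) (Y y)) x = 0 :=
    zero_of_eventually _ (hYF.mono fun y hy ↦ g.inner_normal y _ hy)
  have h2 : mvfderiv (𝓡 (n + 1)) (fun y ↦ g.toMetric.inner y (X y) (N y)) x = 0 :=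
    zero_of_eventually _ (hXF.mono fun y hy ↦ by
      rw [g.toMetric.symm]; exact g.inner_normal y _ hy)
  refine (inner_leviCivitaFun g.toMetric hX hN hY).trans ?_
  -- Only the `Tℱ`-components of the brackets pair with `X` and `Y`; in this form every term uses
  -- the metric on `Tℱ` alone.
  rw [g.inner_hat _ hYF.self_of_nhds, g.inner_hat _ hXF.self_of_nhds]
  simp only [koszul, h1, h2, hXY, mlieBracket_swap_apply (V := N) (W := Y)]
  simp

theorem inner_weingarten (g : AdaptedMetric F N) (x : M) (v w : F.tangent x) :
    g.toMetric.inner x (g.weingarten x v : TangentSpace (𝓡 (n + 1)) x) w =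
      -g.toMetric.inner x (leviCivita g.toMetric N x v) w := by
  rw [← g.inner_hat (leviCivita g.toMetric N x v) w.2]
  simp [weingarten]

/-- The Weingarten operator of the leaves is self-adjoint. -/
theorem inner_weingarten_comm (g : AdaptedMetric F N) {x : M} (hN : MDifferentiableVectorFieldAt (𝓡 (n + 1)) N x)
    (v w : F.tangent x) :
    g.toMetric.inner x (g.weingarten x v : TangentSpace (𝓡 (n + 1)) x) w =
      g.toMetric.inner x v (g.weingarten x w) := by
  obtain ⟨ext, hext, hd, hF, hbr⟩ := F.exists_commuting_extension x
  -- For commuting extensions the formula for `g(∇_X N, Y)` is visibly symmetric in `X` and `Y`.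
  have h1 := g.inner_leviCivita_normal hN (hd v) (hd w) (hF v v.2) (hF w w.2) (hbr v w)
  have h2 := g.inner_leviCivita_normal hN (hd w) (hd v) (hF w w.2) (hF v v.2) (hbr w v)
  have e : (fun y ↦ g.toMetric.inner y (ext w y) (ext v y)) =
      fun y ↦ g.toMetric.inner y (ext v y) (ext w y) := by
    ext y; exact g.toMetric.symm _ _ _
  rw [e] at h2
  simp only [hext] at h1 h2
  rw [g.toMetric.symm x v, inner_weingarten, inner_weingarten, h1, h2]
  ring

/-- Principal curvatures are defined as real roots; self-adjointness ensures that none are missing.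
-/
theorem charpoly_weingarten_splits (g : AdaptedMetric F N) {x : M} (hN : MDifferentiableVectorFieldAt (𝓡 (n + 1)) N x) :
    (g.weingarten x).charpoly.Splits :=
  LinearMap.charpoly_splits_of_symmetric
    ((g.toMetric.bilin x).domRestrict₁₂ (F.tangent x) (F.tangent x))
    (fun v w ↦ g.toMetric.symm x v w)
    (fun v hv ↦ g.toMetric.pos x v (by simpa using hv)) _
    (fun v w ↦ g.inner_weingarten_comm hN v w)

theorem card_principalCurvatures (g : AdaptedMetric F N) {x : M} (hN : MDifferentiableVectorFieldAt (𝓡 (n + 1)) N x) :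
    (g.principalCurvatures x).card = n := by
  rw [principalCurvatures, ← (g.charpoly_weingarten_splits hN).natDegree_eq_card_roots,
    LinearMap.charpoly_natDegree, g.finrank_tangent]

/-- Leafwise conformal adapted metrics have Weingarten operators which differ by a multiple of the
identity at each point. -/
theorem exists_weingarten_eq_add_smul (g g' : AdaptedMetric F N) {ρ : M → ℝ} (hρ : ∀ y, 0 < ρ y)
    (h : ∀ y, ∀ u ∈ F.tangent y, ∀ v ∈ F.tangent y,
      g'.toMetric.inner y u v = ρ y * g.toMetric.inner y u v)
    {x : M} (hN : MDifferentiableVectorFieldAt (𝓡 (n + 1)) N x) :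
    ∃ c : ℝ, g'.weingarten x = g.weingarten x + c • LinearMap.id := by
  -- If `T_xℱ = 0`, any `c` works. Otherwise a non-zero `w` recovers `ρ` from the metrics.
  rcases subsingleton_or_nontrivial (F.tangent x) with hs | hs
  · exact ⟨0, LinearMap.ext fun v ↦ Subsingleton.elim _ _⟩
  obtain ⟨w, hw⟩ := exists_ne (0 : F.tangent x)
  obtain ⟨ext, hext, hd, hF, hbr⟩ := F.exists_commuting_extension x
  -- No regularity of `ρ` is assumed: near `x` it is the quotient `g'(W, W) / g(W, W)`, where `W` is
  -- the tangent extension of `w`.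
  have hρd : MDifferentiableAt (𝓡 (n + 1)) 𝓘(ℝ, ℝ) ρ x := by
    have hg := g.toMetric.mdifferentiableAt (hd w) (hd w)
    have hg' := g'.toMetric.mdifferentiableAt (hd w) (hd w)
    have hpos : 0 < g.toMetric.inner x (ext w x) (ext w x) := by
      rw [hext]
      exact g.toMetric.pos x w (by simpa using hw)
    refine (hg'.div hg hpos.ne').congr_of_eventuallyEq ?_
    filter_upwards [hF w w.2, hg.continuousAt.eventually_ne hpos.ne'] with y hy hy0
    simp only [Pi.div_apply]
    rw [h y _ hy _ hy, mul_div_cancel_right₀ _ hy0]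
  -- The product rule for `N(ρ g(X, Y)) / 2` leaves `N(ρ) g(X, Y) / 2`; passing from `g'` back to
  -- `g` divides it by `ρ`.
  set c := mvfderiv (𝓡 (n + 1)) ρ x (N x) / (2 * ρ x) with hc
  refine ⟨-c, LinearMap.ext fun v ↦ ?_⟩
  have key : ∀ u : F.tangent x,
      g.toMetric.inner x (g'.weingarten x v : TangentSpace (𝓡 (n + 1)) x) u =
        g.toMetric.inner x (g.weingarten x v : TangentSpace (𝓡 (n + 1)) x) u -
          c * g.toMetric.inner x v u := by
    intro u
    have h1 := g.inner_leviCivita_normal hN (hd v) (hd u) (hF v v.2) (hF u u.2) (hbr v u)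
    have h2 := g'.inner_leviCivita_normal hN (hd v) (hd u) (hF v v.2) (hF u u.2) (hbr v u)
    have e : mvfderiv (𝓡 (n + 1)) (fun y ↦ g'.toMetric.inner y (ext v y) (ext u y)) x =
        mvfderiv (𝓡 (n + 1)) (ρ * fun y ↦ g.toMetric.inner y (ext v y) (ext u y)) x := by
      have he : (fun y ↦ g'.toMetric.inner y (ext v y) (ext u y)) =ᶠ[𝓝 x]
          (ρ * fun y ↦ g.toMetric.inner y (ext v y) (ext u y)) := by
        filter_upwards [hF v v.2, hF u u.2] with y hy hy'
        exact h y _ hy _ hy'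
      exact he.mvfderiv_eq
    rw [e, mvfderiv_mul hρd (g.toMetric.mdifferentiableAt (hd v) (hd u))] at h2
    simp only [hext] at h1 h2
    rw [hat_eq g' g, hat_eq g' g, h x _ (g.hat_mem x _) _ u.2, h x _ (g.hat_mem x _) _ v.2] at h2
    have h3 := h x _ (g'.weingarten x v).2 _ u.2
    rw [inner_weingarten, h2] at h3
    rw [inner_weingarten g, h1]
    have := (hρ x).ne'
    apply mul_left_cancel₀ this
    rw [← h3]
    simp [hc]
    field_simp
    ring
  rw [LinearMap.add_apply, LinearMap.smul_apply, LinearMap.id_apply, neg_smul]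
  rw [← sub_eq_zero]
  -- By `key`, `z` is `g`-orthogonal to all of `T_xℱ`, in particular to itself, so positivity forces
  -- `z = 0`.
  set z := g'.weingarten x v - (g.weingarten x v + -(c • v)) with hz
  by_contra hz0
  refine (g.toMetric.pos x z (by simpa using hz0)).ne' ?_
  have h4 : (z : TangentSpace (𝓡 (n + 1)) x) = (g'.weingarten x v : TangentSpace (𝓡 (n + 1)) x) -
      ((g.weingarten x v : TangentSpace (𝓡 (n + 1)) x) -
        c • (v : TangentSpace (𝓡 (n + 1)) x)) := by
    simp [hz, sub_eq_add_neg]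
  have h5 := key z
  conv_lhs => enter [1]; rw [h4]
  simp only [map_sub, map_smul, sub_apply, smul_apply, smul_eq_mul, h5]
  ring

end AdaptedMetric

/-- Along a conformal variation the metrics are leafwise conformal to the initial one. -/
theorem IsConformalVariation.exists_conformal_factor {F : CodimOneFoliation n M}
    {N : Π x : M, TangentSpace (𝓡 (n + 1)) x} {J : Set ℝ} (hJ : J.OrdConnected) (h0 : (0 : ℝ) ∈ J)
    {g : ℝ → AdaptedMetric F N} {s : ℝ → M → ℝ} (hg : IsConformalVariation J g s) {t : ℝ}
    (ht : t ∈ J) :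
    ∃ ρ : M → ℝ, (∀ y, 0 < ρ y) ∧ ∀ y, ∀ u ∈ F.tangent y, ∀ v ∈ F.tangent y,
      (g t).toMetric.inner y u v = ρ y * (g 0).toMetric.inner y u v := by
  suffices H : ∀ y, ∃ r : ℝ, 0 < r ∧ ∀ u ∈ F.tangent y, ∀ v ∈ F.tangent y,
      (g t).toMetric.inner y u v = r * (g 0).toMetric.inner y u v by
    choose ρ hρ h using H
    exact ⟨ρ, hρ, h⟩
  intro y
  rcases subsingleton_or_nontrivial (F.tangent y) with hs | hs
  · refine ⟨1, one_pos, fun u hu v _ ↦ ?_⟩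
    have : u = 0 := congrArg Subtype.val (Subsingleton.elim (⟨u, hu⟩ : F.tangent y) 0)
    simp [this]
  obtain ⟨w, hw⟩ := exists_ne (0 : F.tangent y)
  have hpos : ∀ r, 0 < (g r).toMetric.inner y w w := fun r ↦
    (g r).toMetric.pos y w (by simpa using hw)
  have hderiv : ∀ u ∈ F.tangent y, ∀ v ∈ F.tangent y, ∀ r ∈ J,
      HasDerivWithinAt (fun r ↦ (g r).toMetric.inner y u v)
        (s r y * (g r).toMetric.inner y u v) J r := by
    intro u hu v hv r hr
    have := hg r hr y u v
    rwa [AdaptedMetric.truncated, AdaptedMetric.hat_of_mem _ hu, AdaptedMetric.hat_of_mem _ hv]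
      at this
  refine ⟨(g t).toMetric.inner y w w / (g 0).toMetric.inner y w w, div_pos (hpos t) (hpos 0),
    fun u hu v hv ↦ ?_⟩
  -- Numerator and denominator solve the same linear equation `f' = s f`, so their quotient has zero
  -- derivative on `J`. Thus `s` need not be integrated, and no regularity of it in `t` is required.
  have hconst := hJ.convex.norm_image_sub_le_of_norm_hasDerivWithin_le (C := 0)
    (f := fun r ↦ (g r).toMetric.inner y u v / (g r).toMetric.inner y w w) (f' := fun _ ↦ 0)
    (fun r hr ↦ by
      have h := (hderiv u hu v hv r hr).div (hderiv w w.2 w w.2 r hr) (hpos r).ne'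
      convert! h using 1
      rw [eq_comm, div_eq_zero_iff]
      left
      ring)
    (fun _ _ ↦ by simp) h0 ht
  rw [zero_mul, norm_le_zero_iff, sub_eq_zero, div_eq_div_iff (hpos t).ne' (hpos 0).ne'] at hconst
  rw [div_mul_eq_mul_div, eq_div_iff (hpos 0).ne', hconst]
  ring

end Foliation

/-! ### Translation of the principal curvatures and the main theorem -/

section Conclusion

variable {n : ℕ} {M : Type*} [TopologicalSpace M]
  [ChartedSpace (EuclideanSpace ℝ (Fin (n + 1))) M] [IsManifold (𝓡 (n + 1)) ∞ M]

/-- Along a conformal variation the principal curvatures at each point are translated. -/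
theorem IsConformalVariation.exists_principalCurvatures_eq {F : CodimOneFoliation n M}
    {N : Π x : M, TangentSpace (𝓡 (n + 1)) x} {J : Set ℝ} (hJ : J.OrdConnected) (h0 : (0 : ℝ) ∈ J)
    {g : ℝ → AdaptedMetric F N} {s : ℝ → M → ℝ} (hg : IsConformalVariation J g s) {t : ℝ}
    (ht : t ∈ J) {x : M} (hN : MDifferentiableVectorFieldAt (𝓡 (n + 1)) N x) :
    ∃ c : ℝ, (g t).principalCurvatures x = ((g 0).principalCurvatures x).map (· + c) := by
  obtain ⟨ρ, hρ, h⟩ := hg.exists_conformal_factor hJ h0 ht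
  obtain ⟨c, hc⟩ := AdaptedMetric.exists_weingarten_eq_add_smul (g 0) (g t) hρ h hN
  refine ⟨c, ?_⟩
  rw [AdaptedMetric.principalCurvatures, hc,
    LinearMap.roots_charpoly_add_smul ((g 0).charpoly_weingarten_splits hN)]
  rfl

end Conclusion

theorem mainTheorem11 (n : ℕ) (hn : 1 ≤ n) {M : Type*} [TopologicalSpace M]
    [ChartedSpace (EuclideanSpace ℝ (Fin (n + 1))) M] [IsManifold (𝓡 (n + 1)) ∞ M]
    (F : CodimOneFoliation n M) (N : Π x : M, TangentSpace (𝓡 (n + 1)) x)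
    (hN_smooth : ContMDiff (𝓡 (n + 1)) (𝓡 (n + 1)).tangent ∞
      (fun x ↦ (⟨x, N x⟩ : TangentBundle (𝓡 (n + 1)) M)))
    (hN_transversal : ∀ x, N x ∉ F.tangent x)
    (J : Set ℝ) (hJ : J.OrdConnected) (h0 : (0 : ℝ) ∈ J)
    (g : ℝ → AdaptedMetric F N) (s : ℝ → M → ℝ) (hg : IsConformalVariation J g s) :
    (∀ t ∈ J, ∀ x : M, ∀ k : ℕ, 1 ≤ k →
      (g t).powerSum k x = (powerSumPoly n ((g 0).phi x) k).eval ((g t).powerSum 1 x)) ∧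
    (∀ t ∈ J, ∀ x : M, ∀ k : ℕ, 1 ≤ k → k ≤ n →
      (g t).elemSymm k x = (elemSymmPoly n ((g 0).psi x) k).eval ((g t).elemSymm 1 x)) ∧
    (∀ x : M, ∀ k : ℕ, 2 ≤ k → (g 0).phi x k = (powerSumPoly n ((g 0).phi x) k).eval 0) ∧
    (∀ x : M, ∀ k : ℕ, 2 ≤ k → k ≤ n →
      (g 0).psi x k = (elemSymmPoly n ((g 0).psi x) k).eval 0) ∧
    (∀ (x : M) (y : ℝ),
      (powerSumPoly n ((g 0).phi x) 2).eval y = 1 / (n : ℝ) * y ^ 2 + (g 0).phi x 2 ∧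
      (powerSumPoly n ((g 0).phi x) 3).eval y =
        1 / (n : ℝ) ^ 2 * y ^ 3 + 3 / (n : ℝ) * (g 0).phi x 2 * y + (g 0).phi x 3 ∧
      (powerSumPoly n ((g 0).phi x) 4).eval y =
        1 / (n : ℝ) ^ 3 * y ^ 4 + 6 / (n : ℝ) ^ 2 * (g 0).phi x 2 * y ^ 2 +
          4 / (n : ℝ) * (g 0).phi x 3 * y + (g 0).phi x 4 ∧
      (2 ≤ n → (elemSymmPoly n ((g 0).psi x) 2).eval y =
        ((n : ℝ) - 1) / (2 * (n : ℝ)) * y ^ 2 + (g 0).psi x 2) ∧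
      (3 ≤ n → (elemSymmPoly n ((g 0).psi x) 3).eval y =
        ((n : ℝ) - 1) * ((n : ℝ) - 2) / (6 * (n : ℝ) ^ 2) * y ^ 3 +
          ((n : ℝ) - 2) / (n : ℝ) * (g 0).psi x 2 * y + (g 0).psi x 3)) := by
  have hn0 : n ≠ 0 := by omega
  have hNx (x : M) : MDifferentiableVectorFieldAt (𝓡 (n + 1)) N x :=
    (hN_smooth x).mdifferentiableAt (by simp)
  refine ⟨fun t ht x k hk ↦ ?_, fun t ht x k hk hkn ↦ ?_,
    fun x k hk ↦ (eval_zero_powerSumPoly n _ hk).symm,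
    fun x k hk _ ↦ (eval_zero_elemSymmPoly n _ hk).symm,
    fun x y ↦ ⟨eval_powerSumPoly_two _ y, eval_powerSumPoly_three _ y, eval_powerSumPoly_four _ y,
      fun h ↦ eval_elemSymmPoly_two h _ y, fun h ↦ eval_elemSymmPoly_three h _ y⟩⟩
  · obtain ⟨c, hc⟩ := hg.exists_principalCurvatures_eq hJ h0 ht (hNx x)
    have h := Multiset.sum_map_pow_map_add hn0 ((g 0).card_principalCurvatures (hNx x)) c hk
    rw [← hc] at h
    have h1 : (g t).powerSum 1 x = ((g t).principalCurvatures x).sum := by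
      simp [AdaptedMetric.powerSum]
    rw [h1]
    exact h
  · obtain ⟨c, hc⟩ := hg.exists_principalCurvatures_eq hJ h0 ht (hNx x)
    have h := Multiset.esymm_map_add_eq_eval hn0 ((g 0).card_principalCurvatures (hNx x)) c hk hkn
    rw [← hc] at h
    exact h
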